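/- For a finite simple graph $G=(V,E)$ and $v\in V$ let $N_G(v)$ denote the set of neighbours of $v$. A set $S\subseteq V$ is shattered if for every $B\subseteq S$ there is a vertex $v\in V$ with $N_G(v)\cap S=B$; the VC-dimension of $G$ is the size of the largest shattered set. For $t\in\mathbb{N}$ let $K_2[t]$ denote the complete bipartite graph with two parts of size $t$. Let $d\ge 2$ be an integer and let $c>0$ be a real number. Then there is a constant $c'=c'(c,d)>0$ such that the following holds for every $n$. If $G$ is an $n$-vertex graph of VC-dimension $d$ with $e(G)\ge c\binom{n}{2}$, then $G$ contains a (not necessarily induced) copy of $K_2[t]$ for some integer $t\ge c'\,n^{1/(d+1)}$. -/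

import Mathlib

/-- The VC-dimension of a finite graph: the VC-dimension of the set system
`{N(v) : v ∈ V}` of its (open) vertex neighbourhoods, that is, the size of the largest set of
vertices shattered by the neighbourhoods. -/
def SimpleGraph.vcDim {V : Type*} [Fintype V] [DecidableEq V] (G : SimpleGraph V)
    [DecidableRel G.Adj] : ℕ :=
  (Finset.univ.image fun v : V => G.neighborFinset v).vcDim

/-! Write `x = n^(1/(d+1))` and `δ = c/4`. Take a set `S` of about `δx` vertices of degree at least
`δn`. By averaging, linearly many vertices see a positive proportion of `S`. By Sauer-Shelah they
have only `O(|S|^d)` traces on `S`, so by pigeonhole some `Ω(n / x^d) = Ω(x)` of them share one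
trace. These vertices and their common trace, of size `Ω(x)`, span the biclique; the exponent
`1/(d+1)` balances the two sides. -/

namespace Finset

/-- If a function bounded by `M` on `s` has average at least `2 * θ * M`, then it is at least
`θ * M` on a proportion at least `θ` of `s`. -/
theorem mul_card_le_card_filter_of_le_sum {α : Type*} (s : Finset α) (f : α → ℝ) {M θ : ℝ}
    (hM : 0 < M) (hθ : 0 ≤ θ) (hf : ∀ x ∈ s, f x ≤ M) (h : 2 * θ * M * #s ≤ ∑ x ∈ s, f x) :
    θ * #s ≤ #{x ∈ s | θ * M ≤ f x} := by
  have hlow : ∑ x ∈ s with ¬ θ * M ≤ f x, f x ≤ #s * (θ * M) := by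
    refine (sum_le_card_nsmul _ _ (θ * M) fun x hx => ?_).trans ?_
    · exact (not_le.1 (mem_filter.1 hx).2).le
    · rw [nsmul_eq_mul]
      gcongr
      exact filter_subset _ _
  have hhigh : ∑ x ∈ s with θ * M ≤ f x, f x ≤ #{x ∈ s | θ * M ≤ f x} * M := by
    rw [← nsmul_eq_mul]
    exact sum_le_card_nsmul _ _ _ fun x hx => hf x (mem_filter.1 hx).1
  rw [← sum_filter_add_sum_filter_not s (fun x => θ * M ≤ f x)] at h
  refine le_of_mul_le_mul_right ?_ hM
  linarith

/-- The Sauer-Shelah bound for the traces of a set family on a nonempty set. -/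
theorem card_image_inter_le {α : Type*} [DecidableEq α] (𝒜 : Finset (Finset α)) {s : Finset α}
    (hs : s.Nonempty) : #(𝒜.image (· ∩ s)) ≤ (𝒜.vcDim + 1) * #s ^ 𝒜.vcDim := by
  have hsub : (𝒜.image (· ∩ s)).shatterer ⊆
      (range (𝒜.vcDim + 1)).biUnion fun k => s.powersetCard k := by
    intro t ht
    rw [mem_shatterer] at ht
    have hts : t ⊆ s := by
      obtain ⟨u, hu, htu⟩ := ht.exists_superset
      obtain ⟨a, -, rfl⟩ := mem_image.1 hu
      exact htu.trans inter_subset_right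
    -- Since `t ⊆ s`, cutting down to `s` does not change the traces on `t`.
    have hsh : 𝒜.Shatters t := by
      intro b hb
      obtain ⟨u, hu, rfl⟩ := ht hb
      obtain ⟨a, ha, rfl⟩ := mem_image.1 hu
      refine ⟨a, ha, ?_⟩
      rw [inter_comm a s, ← inter_assoc, inter_eq_left.2 hts]
    simp only [mem_biUnion, mem_range, mem_powersetCard]
    exact ⟨#t, Nat.lt_succ_of_le hsh.card_le_vcDim, hts, rfl⟩
  calc #(𝒜.image (· ∩ s)) ≤ _ := card_le_card_shatterer _
    _ ≤ _ := card_le_card hsub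
    _ ≤ #(range (𝒜.vcDim + 1)) * #s ^ 𝒜.vcDim := by
      refine card_biUnion_le_card_mul _ _ _ fun k hk => ?_
      rw [card_powersetCard]
      exact (Nat.choose_le_pow _ _).trans
        (Nat.pow_le_pow_right hs.card_pos (Nat.lt_succ_iff.1 (mem_range.1 hk)))
    _ = _ := by rw [card_range]

end Finset

namespace SimpleGraph

open Finset

theorem isContained_completeBipartiteGraph_of_le_card {V : Type*} (G : SimpleGraph V) {t : ℕ} {A B : Finset V}
    (hA : t ≤ #A) (hB : t ≤ #B) (h : ∀ a ∈ A, ∀ b ∈ B, G.Adj a b) :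
    (completeBipartiteGraph (Fin t) (Fin t)).IsContained G := by
  obtain ⟨A', hA', hAt⟩ := exists_subset_card_eq hA
  obtain ⟨B', hB', hBt⟩ := exists_subset_card_eq hB
  rw [completeBipartiteGraph_isContained_iff]
  exact ⟨A', B', by simpa using hAt, by simpa using hBt, fun a ha b hb =>
    h a (hA' ha) b (hB' hb)⟩

/-- A dense graph has linearly many vertices of linear degree. -/
theorem mul_card_le_card_filter_degree {V : Type*} [Fintype V] (G : SimpleGraph V)
    [DecidableRel G.Adj] {c : ℝ} (hc : 0 ≤ c) (hV : 2 ≤ Fintype.card V)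
    (hG : c * ((Fintype.card V).choose 2 : ℝ) ≤ (#G.edgeFinset : ℝ)) :
    c / 4 * Fintype.card V ≤ #{v : V | c / 4 * Fintype.card V ≤ (G.degree v : ℝ)} := by
  have hV' : (2 : ℝ) ≤ Fintype.card V := by exact_mod_cast hV
  refine mul_card_le_card_filter_of_le_sum univ (fun v => (G.degree v : ℝ)) (by linarith)
    (by positivity) (fun v _ => ?_) ?_
  · exact_mod_cast (G.degree_lt_card_verts v).le
  · have hdeg : ∑ v, (G.degree v : ℝ) = 2 * #G.edgeFinset := by
      exact_mod_cast G.sum_degrees_eq_twice_card_edges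
    rw [Nat.cast_choose_two] at hG
    rw [hdeg, card_univ]
    -- The degree sum is at least `c n (n - 1)`, and `n - 1 ≥ n / 2` because `n ≥ 2`.
    have : 0 ≤ c * (Fintype.card V * (Fintype.card V - 2 : ℝ)) := by
      have : (0 : ℝ) ≤ Fintype.card V - 2 := by linarith
      positivity
    linarith

variable {V : Type*} [Fintype V] [DecidableEq V] (G : SimpleGraph V) [DecidableRel G.Adj]

theorem vcDim_le_card : G.vcDim ≤ Fintype.card V :=
  Finset.sup_le fun s _ => s.card_le_univ

/-- If every vertex of `S` has degree at least `δ * n`, then at least `δ / 2 * n` vertices have at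
least `δ / 2 * #S` neighbours in `S`. -/
theorem mul_card_le_card_filter_card_inter {δ : ℝ} (hδ : 0 ≤ δ) {S : Finset V} (hS : S.Nonempty)
    (h : ∀ v ∈ S, δ * Fintype.card V ≤ (G.degree v : ℝ)) :
    δ / 2 * Fintype.card V ≤ #{v : V | δ / 2 * #S ≤ (#(G.neighborFinset v ∩ S) : ℝ)} := by
  refine mul_card_le_card_filter_of_le_sum univ (fun v => (#(G.neighborFinset v ∩ S) : ℝ))
    (by exact_mod_cast hS.card_pos) (by positivity) (fun v _ => ?_) ?_
  · exact_mod_cast card_le_card inter_subset_right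
  · have hcount : ∑ v, #(G.neighborFinset v ∩ S) = ∑ s ∈ S, G.degree s := by
      have := sum_card_bipartiteAbove_eq_sum_card_bipartiteBelow (s := univ) (t := S) G.Adj
      convert this using 2 with v _ s _
      · congr 1
        ext w
        simp [bipartiteAbove, and_comm]
      · rw [← card_neighborFinset_eq_degree]
        congr 1
        ext w
        simp [bipartiteBelow, G.adj_comm]
    have hsum : (#S : ℝ) * (δ * Fintype.card V) ≤ ∑ s ∈ S, (G.degree s : ℝ) := by
      rw [← nsmul_eq_mul]
      exact card_nsmul_le_sum _ _ _ h
    have hcount' : ∑ v, (#(G.neighborFinset v ∩ S) : ℝ) = ∑ s ∈ S, (G.degree s : ℝ) := by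
      exact_mod_cast hcount
    rw [hcount', card_univ]
    linarith

/-- Among any set `W` of vertices, many have a common trace on `S`. -/
theorem exists_card_filter_inter_eq {S W : Finset V} (hS : S.Nonempty) (hW : W.Nonempty) :
    ∃ w ∈ W, (#W : ℝ) / ((G.vcDim + 1) * (#S : ℝ) ^ G.vcDim) ≤
      #{v ∈ W | G.neighborFinset v ∩ S = G.neighborFinset w ∩ S} := by
  set 𝒜 := univ.image fun v : V => G.neighborFinset v with h𝒜
  have hcard : #(W.image fun v => G.neighborFinset v ∩ S) ≤ (G.vcDim + 1) * #S ^ G.vcDim := by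
    refine (card_le_card ?_).trans (card_image_inter_le 𝒜 hS)
    intro t ht
    obtain ⟨v, -, rfl⟩ := mem_image.1 ht
    exact mem_image_of_mem _ (mem_image_of_mem _ (mem_univ v))
  have hcard' : (#(W.image fun v => G.neighborFinset v ∩ S) : ℝ) ≤
      (G.vcDim + 1) * (#S : ℝ) ^ G.vcDim := by exact_mod_cast hcard
  have hpos : 0 < (G.vcDim + 1) * (#S : ℝ) ^ G.vcDim := by
    have : (0 : ℝ) < #S := by exact_mod_cast hS.card_pos
    positivity
  obtain ⟨y, hy, hle⟩ := exists_le_card_fiber_of_nsmul_le_card_of_maps_to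
    (b := (#W : ℝ) / ((G.vcDim + 1) * (#S : ℝ) ^ G.vcDim))
    (fun v hv => mem_image_of_mem (fun v => G.neighborFinset v ∩ S) hv) (hW.image _) (by
      rw [nsmul_eq_mul, mul_div_assoc', div_le_iff₀ hpos, mul_comm]
      gcongr)
  obtain ⟨w, hw, rfl⟩ := mem_image.1 hy
  exact ⟨w, hw, hle⟩

end SimpleGraph

-- The equation for `x` makes it the `(d+1)`-th root of `n` while keeping real powers out of the
-- argument.
open Finset in
theorem SimpleGraph.exists_isContained_completeBipartiteGraph {V : Type*} [Fintype V]
    [DecidableEq V] (G : SimpleGraph V) [DecidableRel G.Adj] {c x : ℝ} (hc : 0 < c)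
    (hV : 2 ≤ Fintype.card V) (hx : 0 ≤ x) (hxV : x ^ (G.vcDim + 1) = Fintype.card V)
    (hG : c * ((Fintype.card V).choose 2 : ℝ) ≤ (#G.edgeFinset : ℝ)) :
    ∃ t : ℕ, (c / 4) ^ 2 / (4 * (G.vcDim + 1)) * x ≤ t ∧
      (completeBipartiteGraph (Fin t) (Fin t)).IsContained G := by
  set d := G.vcDim with hd
  set n := Fintype.card V with hn
  have hn0 : (0 : ℝ) < n := by exact_mod_cast (by omega : 0 < n)
  have hchoose : (0 : ℝ) < n.choose 2 := by exact_mod_cast Nat.choose_pos hV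
  have hedge : (0 : ℝ) < #G.edgeFinset := (by positivity : 0 < c * (n.choose 2 : ℝ)).trans_le hG
  have hc1 : c ≤ 1 := by
    have : (#G.edgeFinset : ℝ) ≤ n.choose 2 := by exact_mod_cast G.card_edgeFinset_le_card_choose_two
    exact le_of_mul_le_mul_right (by linarith) hchoose
  set δ := c / 4 with hδ
  have hδ0 : 0 < δ := by positivity
  have hδ1 : δ ≤ 1 := by linarith
  have hκ : δ ^ 2 / (4 * (d + 1)) * x ≤ δ ^ 2 / 4 * x := by
    gcongr
    have : (0 : ℝ) ≤ d := by positivity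
    linarith
  -- If `δx < 1`, then `S` would be empty, but the target is below 1 and a single edge suffices.
  rcases lt_or_ge (δ * x) 1 with hsmall | hlarge
  · obtain ⟨e, he⟩ := card_pos.1 (by exact_mod_cast hedge : 0 < #G.edgeFinset)
    induction e with | _ a b
    rw [mem_edgeFinset, mem_edgeSet] at he
    refine ⟨1, ?_, G.isContained_completeBipartiteGraph_of_le_card (A := {a}) (B := {b})
      (by simp) (by simp) (by simpa using he)⟩
    rw [Nat.cast_one]
    nlinarith
  have hx1 : 1 ≤ x := by nlinarith
  have hxn : x ≤ n := by
    rw [← hxV]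
    exact le_self_pow₀ hx1 (by omega)
  have hm1 : 1 ≤ ⌊δ * x⌋₊ := Nat.one_le_floor_iff _ |>.2 hlarge
  have hmle : (⌊δ * x⌋₊ : ℝ) ≤ δ * x := Nat.floor_le (by positivity)
  have hmge : δ * x / 2 ≤ (⌊δ * x⌋₊ : ℝ) := by
    have := Nat.lt_floor_add_one (δ * x)
    have : (1 : ℝ) ≤ ⌊δ * x⌋₊ := by exact_mod_cast hm1
    linarith
  obtain ⟨S, hSH, hSm⟩ := exists_subset_card_eq
    (s := ({v : V | δ * n ≤ (G.degree v : ℝ)} : Finset V)) (n := ⌊δ * x⌋₊) (by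
      have h1 := G.mul_card_le_card_filter_degree hc.le hV hG
      have h2 : δ * x ≤ δ * n := by gcongr
      exact_mod_cast (hmle.trans h2).trans h1)
  have hS : S.Nonempty := card_pos.1 (by omega)
  have hS0 : (0 : ℝ) < #S := by exact_mod_cast hS.card_pos
  have hWcard := G.mul_card_le_card_filter_card_inter hδ0.le hS
    fun v hv => (mem_filter.1 (hSH hv)).2
  set W : Finset V := {v : V | δ / 2 * #S ≤ (#(G.neighborFinset v ∩ S) : ℝ)} with hWdef
  have hW : W.Nonempty := card_pos.1 (by
    exact_mod_cast (by positivity : 0 < δ / 2 * (n : ℝ)).trans_le hWcard)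
  obtain ⟨w, hw, hclass⟩ := G.exists_card_filter_inter_eq hS hW
  refine ⟨⌈δ ^ 2 / (4 * (d + 1)) * x⌉₊, Nat.le_ceil _,
    G.isContained_completeBipartiteGraph_of_le_card
      (A := {v ∈ W | G.neighborFinset v ∩ S = G.neighborFinset w ∩ S})
      (B := G.neighborFinset w ∩ S) (Nat.ceil_le.2 ?_) (Nat.ceil_le.2 ?_) ?_⟩
  · refine le_trans ?_ hclass
    rw [le_div_iff₀ (by positivity)]
    refine le_trans ?_ hWcard
    -- As `|S| ≤ δx ≤ x`, the number of traces is at most `(d + 1) x^d = (d + 1) n / x`.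
    have hSx : (#S : ℝ) ^ d ≤ x ^ d := by
      rw [hSm]
      gcongr
      nlinarith
    calc δ ^ 2 / (4 * (d + 1)) * x * ((d + 1) * (#S : ℝ) ^ d)
        ≤ δ ^ 2 / (4 * (d + 1)) * x * ((d + 1) * x ^ d) := by gcongr
      _ = δ ^ 2 / 4 * x ^ (d + 1) := by field_simp; ring
      _ ≤ δ / 2 * n := by
        rw [hxV]
        gcongr ?_ * _
        nlinarith
  -- The trace has at least `(δ/2)|S| ≥ (δ/2)(δx/2)` elements, whence the factor `δ²/4`.
  · refine hκ.trans (le_trans ?_ (mem_filter.1 hw).2)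
    rw [hSm]
    nlinarith
  · intro a ha b hb
    rw [← (mem_filter.1 ha).2, mem_inter, mem_neighborFinset] at hb
    exact hb.1

theorem proposition6p1 (d : ℕ) (hd : 2 ≤ d) (c : ℝ) (hc : 0 < c) :
    ∃ c' : ℝ, 0 < c' ∧
      ∀ (V : Type*) [Fintype V] [DecidableEq V] (G : SimpleGraph V) [DecidableRel G.Adj],
        G.vcDim = d →
        c * ((Fintype.card V).choose 2 : ℝ) ≤ (G.edgeFinset.card : ℝ) →
        ∃ t : ℕ, c' * (Fintype.card V : ℝ) ^ (1 / ((d : ℝ) + 1)) ≤ (t : ℝ) ∧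
          SimpleGraph.IsContained (completeBipartiteGraph (Fin t) (Fin t)) G := by
  refine ⟨(c / 4) ^ 2 / (4 * (d + 1)), by positivity, ?_⟩
  intro V _ _ G _ hG hedge
  subst hG
  -- The bound `d ≥ 2` serves only to give `n ≥ 2`.
  refine G.exists_isContained_completeBipartiteGraph hc (hd.trans G.vcDim_le_card)
    (by positivity) ?_ hedge
  rw [← Real.rpow_natCast, ← Real.rpow_mul (by positivity)]
  push_cast
  rw [one_div_mul_cancel (by positivity), Real.rpow_one]
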